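/- **Setting.** Simple types are generated by $\alpha,\beta ::= \mathsf{int}\mid\alpha\to\beta$. PCF terms (up to renaming of bound variables) are $P,Q,Q' ::= x\mid P\cdot Q\mid\lambda x.P\mid\mathbf 0\mid\mathbf{pred}\,P\mid\mathbf{succ}\,P\mid\mathbf{ifz}(P,Q,Q')\mid\mathbf{fix}\,P$, with the usual simple typing rules ($\mathbf{fix}\,P:\alpha$ if $P:\alpha\to\alpha$); a program is a closed term; $\underline n=\mathbf{succ}^n(\mathbf 0)$; values are abstractions and numerals. The call-by-name big-step semantics $P\Downarrow U$ is given by the rules: $U\Downarrow U$ for $U$ a value; $\mathbf{pred}\,P\Downarrow\underline 0$ if $P\Downarrow\underline 0$; $\mathbf{pred}\,P\Downarrow\underline n$ if $P\Downarrow\underline{n+1}$; $\mathbf{succ}\,P\Downarrow\underline{n+1}$ if $P\Downarrow\underline n$; $\mathbf{ifz}(P,Q,Q')\Downarrow U$ if $P\Downarrow\underline 0$ and $Q\Downarrow U$, or if $P\Downarrow\underline{n+1}$ and $Q'\Downarrow U$; $\mathbf{fix}\,P\Downarrow U$ if $P\cdot(\mathbf{fix}\,P)\Downarrow U$; $P\cdot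 Q\Downarrow U$ if $P\Downarrow\lambda x.P'$ and $P'[Q/x]\Downarrow U$. **Machines.** Let $\mathbb A$ be a countably infinite set of addresses containing $\mathbb N$, with $\mathbb A\setminus\mathbb N$ infinite. An *extended addressing machine* (EAM) is a tuple $\langle R_0,\dots,R_{r-1},P,T\rangle$ of registers, each holding an address or the null constant $\varnothing$; a tape $T$, i.e. a finite list of addresses; and a program $P$, i.e. a list of instructions $\mathtt{Load}\,i$, followed by a list of instructions $\mathtt{App}\,i\,j\,k$, $\mathtt{Test}\,i\,j\,k\,l$, $\mathtt{Pred}\,i\,j$, $\mathtt{Succ}\,i\,j$, possibly followed by one $\mathtt{Call}\,i$. The program never reads an uninitialised register, and only $\mathtt{Load}$ may write to a non-existing register (which has no effect). $M@T'$ is $M$ with $T'$ appended to its tape. The numeral machine is $\mathsf n=\langle R_0=n,\varepsilon,[\,]\rangle$. For $a\in\mathbb A$, $\mathsf Y_n^a$ has registers $R_0=a$, $R_1=\dots=R_{n+1}=\varnothing$, empty tape and program $\mathtt{Load}(1,\dots,n{+}1);\ \mathtt{App}\,0\,1\,0;\dots;\mathtt{App}\,0\,(n{+}1)\,0;\ \mathtt{App}\,1\,2\,1;\dots;\mathtt{App}\,1\,(n{+}1)\,1;\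 \mathtt{App}\,1\,0\,1;\ \mathtt{Call}\,1$. Let $\#$ be any *address table map*: a bijection from EAMs onto $\mathbb A$ with $\#\mathsf n=n$ for all $n\in\mathbb N$ and such that for every $n$ there is $a\in\mathbb A\setminus\mathbb N$ with $\#(\mathsf Y_n^a)=a$; write $\mathsf Y_n$ for such a machine $\mathsf Y_n^a$. Put $a\cdot b=\#(\#^{-1}(a)@[b])$. **Reduction.** A machine is *final* if its program is empty, or starts with $\mathtt{Load}$ while its tape is empty. One step $\to_{\mathsf c}$ executes the first instruction and removes it: $\mathtt{Load}\,i$ moves the first tape element to $R_i$; $\mathtt{App}\,i\,j\,k$ sets $R_k:=R_i\cdot R_j$; $\mathtt{Call}\,i$ replaces the machine by $\#^{-1}(R_i)@T$. For $\mathtt{Pred}\,i\,j$, $\mathtt{Succ}\,i\,j$ and $\mathtt{Test}\,i\,j\,k\,l$: if $\#^{-1}(R_i)\to_{\mathsf c}N$, then $R_i:=\#N$ and the instruction is kept (an error of $\#^{-1}(R_i)$ is passed on); if $\#^{-1}(R_i)$ is final and $R_i\in\mathbb N$, then respectively $R_j:=\max(R_i-1,0)$, $R_j:=R_i+1$, and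 $R_l:=R_j$ if $R_i=0$, $R_l:=R_k$ if $R_i>0$; if $\#^{-1}(R_i)$ is final and $R_i\notin\mathbb N$, an error is raised. Let $\twoheadrightarrow_{\mathsf c}$ be the reflexive-transitive closure of $\to_{\mathsf c}$. **Translation.** The following machines have all registers uninitialised and an empty tape. $\mathsf{Pr}^n_i$ ($n$ registers): $\mathtt{Load}(0,\dots,n{-}1);\mathtt{Call}\,(i{-}1)$. $\mathsf{Apply}_n$ ($n+2$ registers): $\mathtt{Load}(0,\dots,n{+}1);\mathtt{App}\,0\,2\,0;\dots;\mathtt{App}\,0\,(n{+}1)\,0;\mathtt{App}\,1\,2\,1;\dots;\mathtt{App}\,1\,(n{+}1)\,1;\mathtt{App}\,0\,1\,0;\mathtt{Call}\,0$. $\mathsf{Pred}_n$ and $\mathsf{Succ}_n$ ($n+1$ registers): $\mathtt{Load}(0,\dots,n);\mathtt{App}\,0\,1\,0;\dots;\mathtt{App}\,0\,n\,0;\mathtt I\,0\,0;\mathtt{Call}\,0$ with $\mathtt I=\mathtt{Pred}$, resp. $\mathtt I=\mathtt{Succ}$. $\mathsf{Ifz}_n$ ($n+3$ registers): $\mathtt{Load}(0,\dots,n{+}2)$;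 then $\mathtt{App}\,i\,3\,i;\dots;\mathtt{App}\,i\,(n{+}2)\,i$ for $i=0,1,2$ in turn; then $\mathtt{Test}\,0\,1\,2\,0;\mathtt{Call}\,0$. For a PCF term $P$ with free variables among $\vec x=x_1,\dots,x_n$, the EAM $|P|_{\vec x}$ is defined by $$|x_i|_{\vec x}=\mathsf{Pr}^n_i,\quad |\lambda y.P|_{\vec x}=|P|_{\vec x,y},\quad |P\cdot Q|_{\vec x}=\mathsf{Apply}_n@[\#|P|_{\vec x},\#|Q|_{\vec x}],\quad |\underline k|_{\vec x}=\mathsf{Pr}^{n+1}_1@[k],$$ $$|\mathbf{pred}\,P|_{\vec x}=\mathsf{Pred}_n@[\#|P|_{\vec x}],\quad |\mathbf{succ}\,P|_{\vec x}=\mathsf{Succ}_n@[\#|P|_{\vec x}]\ \text{ if } \mathbf{succ}\,P \text{ is not a numeral},$$ $$|\mathbf{ifz}(P,Q,Q')|_{\vec x}=\mathsf{Ifz}_n@[\#|P|_{\vec x},\#|Q|_{\vec x},\#|Q'|_{\vec x}],\quad |\mathbf{fix}\,P|_{\vec x}=\mathsf Y_n@[\#|P|_{\vec x}].$$ (This is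 the restriction, to terms whose explicit substitutions are all empty, of the translation of PCF with explicit substitutions, for which $|\lambda y.M\langle\sigma\rangle|_{\vec x}=|\sigma,M|_{\vec x,y}$, $|[\,],M|_{\vec x}=|M|_{\vec x}$ and $|\sigma+[z\leftarrow(\tau,N)],M|_{\vec x}=|\sigma,M|_{z,\vec x}@[\#|\tau,N|]$, where $|\tau,N|$ is taken with respect to no variables.) **Theorem.** For every address table map $\#$, every PCF program $P$ with $\vdash P:\mathsf{int}$ and every $n\in\mathbb N$: if $P\Downarrow\underline n$, then $|P|\twoheadrightarrow_{\mathsf c}\mathsf n$, where $|P|$ is the translation with respect to no variables. -/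

import Mathlib

/-! Programs and extended addressing machines. -/

/-- End of a program: `Call i`, or the empty string. -/
inductive CProg : Type
  | call (i : ℕ)
  | eps

/-- Middle part of a program: a list of `App`, `Test` (`Ifz`), `Pred`, `Succ` instructions. -/
inductive AProg : Type
  | app (i j k : ℕ) (P : AProg)
  | test (i j k l : ℕ) (P : AProg)
  | pred (i j : ℕ) (P : AProg)
  | succ (i j : ℕ) (P : AProg)
  | last (C : CProg)

/-- Programs: a list of `Load` instructions followed by a middle part. -/
inductive Prog : Type
  | load (i : ℕ) (P : Prog)
  | body (P : AProg)

/-- `I ⊨^r P`: the program, run on `r` registers of which those in `I` are initialised, never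
reads an uninitialised register. -/
def CProg.Valid (I : Set ℕ) : CProg → Prop
  | .call i => i ∈ I
  | .eps => True

/-- See `CProg.Valid`. -/
def AProg.Valid (r : ℕ) : Set ℕ → AProg → Prop
  | I, .app i j k P => i ∈ I ∧ j ∈ I ∧ k < r ∧ AProg.Valid r (insert k I) P
  | I, .test i j k l P => i ∈ I ∧ j ∈ I ∧ k ∈ I ∧ l < r ∧ AProg.Valid r (insert l I) P
  | I, .pred i j P => i ∈ I ∧ j < r ∧ AProg.Valid r (insert j I) P
  | I, .succ i j P => i ∈ I ∧ j < r ∧ AProg.Valid r (insert j I) P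
  | I, .last C => C.Valid I

/-- See `CProg.Valid`. -/
def Prog.Valid (r : ℕ) : Set ℕ → Prog → Prop
  | I, .load i P => (i < r ∧ Prog.Valid r (insert i I) P) ∨ (r ≤ i ∧ Prog.Valid r I P)
  | I, .body P => P.Valid r I

/-- Register `i` exists in `R` and holds the address `a`. Registers are lists over `Option A`,
`none` being the null constant of an uninitialised register. Writing is `List.set`, which leaves
the list unchanged if the index is out of range. -/
def Holds {A : Type*} (R : List (Option A)) (i : ℕ) (a : A) : Prop :=
  R[i]? = some (some a)

/-- The set of (indices of) initialised registers. -/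
def initialised {A : Type*} (R : List (Option A)) : Set ℕ :=
  {i | ∃ a, Holds R i a}

/-- Extended addressing machines over the set `A` of addresses. -/
structure EAM (A : Type*) where
  regs : List (Option A)
  prog : Prog
  tape : List A
  valid : prog.Valid regs.length (initialised regs)

/-- `M @ T`: the tape of `M` is extended by `T`. -/
def EAM.append {A : Type*} (M : EAM A) (T : List A) : EAM A :=
  ⟨M.regs, M.prog, M.tape ++ T, M.valid⟩

/-! Building programs. -/

/-- `Load (i₁, …, iₖ); P` -/
def loads : List ℕ → AProg → Prog
  | [], P => .body P
  | i :: l, P => .load i (loads l P)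

/-- `App i j₁ i; …; App i jₖ i; P` -/
def apps (i : ℕ) : List ℕ → AProg → AProg
  | [], P => P
  | j :: l, P => .app i j i (apps i l P)

theorem loads_valid {r : ℕ} {P : AProg} (l : List ℕ) :
    ∀ {I : Set ℕ}, (∀ i ∈ l, i < r) → P.Valid r (I ∪ {i | i ∈ l}) → (loads l P).Valid r I := by
  induction l with
  | nil => intro I _ h; simpa [loads, Prog.Valid] using h
  | cons i l ih =>
    intro I hl h
    refine Or.inl ⟨hl i (by simp), ih (fun j hj => hl j (by simp [hj])) ?_⟩
    convert h using 1
    ext x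
    simp
    tauto

theorem apps_valid {r i : ℕ} {P : AProg} (l : List ℕ) {I : Set ℕ} (hr : i < r) (hi : i ∈ I)
    (hl : ∀ j ∈ l, j ∈ I) (h : P.Valid r I) : (apps i l P).Valid r I := by
  induction l with
  | nil => exact h
  | cons j l ih =>
    refine ⟨hi, hl j (by simp), hr, ?_⟩
    rw [Set.insert_eq_of_mem hi]
    exact ih (fun k hk => hl k (by simp [hk]))

/-! The particular machines used below. -/

/-- The machine `⟨R₀ = a, ε, []⟩`; the `n`-th numeral machine when `a` is the address `n`. -/
def EAM.const {A : Type*} (a : A) : EAM A :=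
  ⟨[some a], .body (.last .eps), [], trivial⟩

theorem mem_initialised_cons {A : Type*} (a : A) (R : List (Option A)) :
    0 ∈ initialised (some a :: R) := ⟨a, by simp [Holds]⟩

/-- The machine `Y_n^a`, with registers `R₀ = a, R₁ = ∅, …, Rₙ₊₁ = ∅`, empty tape and program
`Load (1, …, n+1); App 0 1 0; …; App 0 (n+1) 0; App 1 2 1; …; App 1 (n+1) 1; App 1 0 1; Call 1`. -/
def EAM.fixpt {A : Type*} (n : ℕ) (a : A) : EAM A where
  regs := some a :: List.replicate (n + 1) none
  prog := loads (List.range' 1 (n + 1))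
    (apps 0 (List.range' 1 (n + 1)) (apps 1 (List.range' 2 n) (.app 1 0 1 (.last (.call 1)))))
  tape := []
  valid := by
    have h0 := mem_initialised_cons a (List.replicate (n + 1) none)
    refine loads_valid _ (by simp; omega) ?_
    refine apps_valid _ (by simp) (Or.inl h0) (fun j hj => Or.inr hj) ?_
    refine apps_valid _ (by simp) (Or.inr (by simp)) (fun j hj => Or.inr ?_) ?_
    · simp at hj ⊢; omega
    · exact ⟨Or.inr (by simp), Or.inl h0, by simp, by simp [AProg.Valid, CProg.Valid]⟩

/-- The projection machine with `n` registers and program `Load (0, …, n-1); Call i`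
(here `i` counts from `0`). -/
def EAM.proj (A : Type*) (n : ℕ) (i : Fin n) : EAM A where
  regs := List.replicate n none
  prog := loads (List.range n) (.last (.call i))
  tape := []
  valid := loads_valid _ (by simp) (by simp [AProg.Valid, CProg.Valid])

/-- The application machine, with `n + 2` registers and program `Load (0, …, n+1);
App 0 2 0; …; App 0 (n+1) 0; App 1 2 1; …; App 1 (n+1) 1; App 0 1 0; Call 0`. -/
def EAM.apply (A : Type*) (n : ℕ) : EAM A where
  regs := List.replicate (n + 2) none
  prog := loads (List.range (n + 2))
    (apps 0 (List.range' 2 n) (apps 1 (List.range' 2 n) (.app 0 1 0 (.last (.call 0)))))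
  tape := []
  valid := by
    refine loads_valid _ (by simp) ?_
    refine apps_valid _ (by simp) (Or.inr (by simp)) (fun j hj => Or.inr ?_) ?_
    · simp at hj ⊢; omega
    refine apps_valid _ (by simp) (Or.inr (by simp)) (fun j hj => Or.inr ?_) ?_
    · simp at hj ⊢; omega
    · exact ⟨Or.inr (by simp), Or.inr (by simp), by simp, by simp [AProg.Valid, CProg.Valid]⟩

/-- The predecessor machine, with `n + 1` registers and program
`Load (0, …, n); App 0 1 0; …; App 0 n 0; Pred 0 0; Call 0`. -/
def EAM.predecessor (A : Type*) (n : ℕ) : EAM A where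
  regs := List.replicate (n + 1) none
  prog := loads (List.range (n + 1)) (apps 0 (List.range' 1 n) (.pred 0 0 (.last (.call 0))))
  tape := []
  valid := by
    refine loads_valid _ (by simp) ?_
    refine apps_valid _ (by simp) (Or.inr (by simp)) (fun j hj => Or.inr ?_) ?_
    · simp at hj ⊢; omega
    · exact ⟨Or.inr (by simp), by simp, by simp [AProg.Valid, CProg.Valid]⟩

/-- The successor machine, with `n + 1` registers and program
`Load (0, …, n); App 0 1 0; …; App 0 n 0; Succ 0 0; Call 0`. -/
def EAM.successor (A : Type*) (n : ℕ) : EAM A where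
  regs := List.replicate (n + 1) none
  prog := loads (List.range (n + 1)) (apps 0 (List.range' 1 n) (.succ 0 0 (.last (.call 0))))
  tape := []
  valid := by
    refine loads_valid _ (by simp) ?_
    refine apps_valid _ (by simp) (Or.inr (by simp)) (fun j hj => Or.inr ?_) ?_
    · simp at hj ⊢; omega
    · exact ⟨Or.inr (by simp), by simp, by simp [AProg.Valid, CProg.Valid]⟩

/-- The conditional machine, with `n + 3` registers and program `Load (0, …, n+2);
App 0 3 0; …; App 0 (n+2) 0; App 1 3 1; …; App 1 (n+2) 1; App 2 3 2; …; App 2 (n+2) 2;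
Test 0 1 2 0; Call 0`. -/
def EAM.ifZero (A : Type*) (n : ℕ) : EAM A where
  regs := List.replicate (n + 3) none
  prog := loads (List.range (n + 3))
    (apps 0 (List.range' 3 n) (apps 1 (List.range' 3 n) (apps 2 (List.range' 3 n)
      (.test 0 1 2 0 (.last (.call 0))))))
  tape := []
  valid := by
    refine loads_valid _ (by simp) ?_
    refine apps_valid _ (by simp) (Or.inr (by simp)) (fun j hj => Or.inr ?_) ?_
    · simp at hj ⊢; omega
    refine apps_valid _ (by simp) (Or.inr (by simp)) (fun j hj => Or.inr ?_) ?_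
    · simp at hj ⊢; omega
    refine apps_valid _ (by simp) (Or.inr (by simp)) (fun j hj => Or.inr ?_) ?_
    · simp at hj ⊢; omega
    · exact ⟨Or.inr (by simp), Or.inr (by simp), Or.inr (by simp), by simp,
        by simp [AProg.Valid, CProg.Valid]⟩

/-! Address table maps and the reduction of machines. -/

/-- An address table map over `A`: a copy `num` of the natural numbers with infinite complement
inside `A`, and a bijection `addr` (written `#`) from machines to addresses, such that the `n`-th
numeral machine has address `n`, and such that for each `n` there is an address `a = fixAddr n`
outside the natural numbers with `#(Y_n^a) = a`. -/
structure AddressTable (A : Type*) where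
  num : ℕ ↪ A
  infinite_compl : (Set.range num)ᶜ.Infinite
  addr : EAM A ≃ A
  addr_numeral : ∀ n, addr (EAM.const (num n)) = num n
  fixAddr : ℕ → A
  fixAddr_not_num : ∀ n, fixAddr n ∉ Set.range num
  addr_fixpt : ∀ n, addr (EAM.fixpt n (fixAddr n)) = fixAddr n

namespace AddressTable

/-- The `n`-th numeral machine. -/
def numeral {A : Type*} (t : AddressTable A) (n : ℕ) : EAM A :=
  EAM.const (t.num n)

/-- The machine `Y_n`. -/
def fixMachine {A : Type*} (t : AddressTable A) (n : ℕ) : EAM A :=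
  EAM.fixpt n (t.fixAddr n)

/-- The machine having a given address. -/
def lookup {A : Type*} (t : AddressTable A) (a : A) : EAM A :=
  t.addr.symm a

/-- The application map `a · b = #(#⁻¹(a) @ [b])`. -/
def appAddr {A : Type*} (t : AddressTable A) (a b : A) : A :=
  t.addr ((t.lookup a).append [b])

end AddressTable

/-- Final states: the program is empty, or it starts with a `Load` while the tape is empty. In all
other cases the first instruction can be executed. (Writing this out, rather than as the
negation of reducibility, makes `Step` below an inductive definition with positive premises.) -/
def EAM.IsFinal {A : Type*} (M : EAM A) : Prop :=
  M.prog = .body (.last .eps) ∨ ∃ i P, M.prog = .load i P ∧ M.tape = []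

/-- The target of a step: a machine or the constant `err`. -/
inductive Outcome (A : Type*) : Type _
  | mach (M : EAM A)
  | err

/-- The one-step reduction of machines. The proofs `h`, `h'` only say that source and target are
machines, i.e. that their programs are valid; validity is preserved by all the rules. A `Pred`,
`Succ` or `Test` instruction first runs the machine addressed by `Rᵢ` until it is final; an error
raised meanwhile is passed on. -/
inductive AddressTable.Step {A : Type*} (t : AddressTable A) : EAM A → Outcome A → Prop
  | call {R i T a h} (hi : Holds R i a) :
      Step t ⟨R, .body (.last (.call i)), T, h⟩ (.mach ((t.lookup a).append T))
  | load {R i P a T h h'} :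
      Step t ⟨R, .load i P, a :: T, h⟩ (.mach ⟨R.set i (some a), P, T, h'⟩)
  | app {R i j k P T a b h h'} (hi : Holds R i a) (hj : Holds R j b) :
      Step t ⟨R, .body (.app i j k P), T, h⟩
        (.mach ⟨R.set k (some (t.appAddr a b)), .body P, T, h'⟩)
  | pred {R i j P T n h h'} (hi : Holds R i (t.num n)) (hf : (t.lookup (t.num n)).IsFinal) :
      Step t ⟨R, .body (.pred i j P), T, h⟩
        (.mach ⟨R.set j (some (t.num (n - 1))), .body P, T, h'⟩)
  | pred_err {R i j P T a h} (hi : Holds R i a) (hf : (t.lookup a).IsFinal)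
      (ha : a ∉ Set.range t.num) :
      Step t ⟨R, .body (.pred i j P), T, h⟩ .err
  | pred_run {R i j P T a N h h'} (hi : Holds R i a) (hs : Step t (t.lookup a) (.mach N)) :
      Step t ⟨R, .body (.pred i j P), T, h⟩
        (.mach ⟨R.set i (some (t.addr N)), .body (.pred i j P), T, h'⟩)
  | pred_run_err {R i j P T a h} (hi : Holds R i a) (hs : Step t (t.lookup a) .err) :
      Step t ⟨R, .body (.pred i j P), T, h⟩ .err
  | succ {R i j P T n h h'} (hi : Holds R i (t.num n)) (hf : (t.lookup (t.num n)).IsFinal) :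
      Step t ⟨R, .body (.succ i j P), T, h⟩
        (.mach ⟨R.set j (some (t.num (n + 1))), .body P, T, h'⟩)
  | succ_err {R i j P T a h} (hi : Holds R i a) (hf : (t.lookup a).IsFinal)
      (ha : a ∉ Set.range t.num) :
      Step t ⟨R, .body (.succ i j P), T, h⟩ .err
  | succ_run {R i j P T a N h h'} (hi : Holds R i a) (hs : Step t (t.lookup a) (.mach N)) :
      Step t ⟨R, .body (.succ i j P), T, h⟩
        (.mach ⟨R.set i (some (t.addr N)), .body (.succ i j P), T, h'⟩)
  | succ_run_err {R i j P T a h} (hi : Holds R i a) (hs : Step t (t.lookup a) .err) :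
      Step t ⟨R, .body (.succ i j P), T, h⟩ .err
  | test_zero {R i j k l P T b h h'} (hi : Holds R i (t.num 0)) (hj : Holds R j b)
      (hf : (t.lookup (t.num 0)).IsFinal) :
      Step t ⟨R, .body (.test i j k l P), T, h⟩ (.mach ⟨R.set l (some b), .body P, T, h'⟩)
  | test_pos {R i j k l P T n c h h'} (hi : Holds R i (t.num (n + 1))) (hk : Holds R k c)
      (hf : (t.lookup (t.num (n + 1))).IsFinal) :
      Step t ⟨R, .body (.test i j k l P), T, h⟩ (.mach ⟨R.set l (some c), .body P, T, h'⟩)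
  | test_err {R i j k l P T a h} (hi : Holds R i a) (hf : (t.lookup a).IsFinal)
      (ha : a ∉ Set.range t.num) :
      Step t ⟨R, .body (.test i j k l P), T, h⟩ .err
  | test_run {R i j k l P T a N h h'} (hi : Holds R i a) (hs : Step t (t.lookup a) (.mach N)) :
      Step t ⟨R, .body (.test i j k l P), T, h⟩
        (.mach ⟨R.set i (some (t.addr N)), .body (.test i j k l P), T, h'⟩)
  | test_run_err {R i j k l P T a h} (hi : Holds R i a) (hs : Step t (t.lookup a) .err) :
      Step t ⟨R, .body (.test i j k l P), T, h⟩ .err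

/-- Multistep reduction between machines (`err` is never the source of a step). -/
def AddressTable.Reduces {A : Type*} (t : AddressTable A) : EAM A → EAM A → Prop :=
  Relation.ReflTransGen fun M N => t.Step M (.mach N)

/-! Terms with explicit substitutions and their translation into machines. -/

mutual
/-- EPCF terms up to renaming of bound variables, with free variables among `x₁, …, xₙ`, in
de Bruijn notation: the index `i : Fin n` stands for `xₙ₋ᵢ`, so that `0` is the most recent
variable. In `lam σ M`, which is `λy.M⟨σ⟩` with `dom σ = {z₁, …, zₘ}`, the variables available to
`M` are `z₁, …, zₘ, x₁, …, xₙ, y` in this order. -/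
inductive ETerm : ℕ → Type
  | var {n : ℕ} (i : Fin n) : ETerm n
  | app {n : ℕ} (M N : ETerm n) : ETerm n
  | lam {n m : ℕ} (σ : ESubst m) (M : ETerm (n + 1 + m)) : ETerm n
  | zero {n : ℕ} : ETerm n
  | pred {n : ℕ} (M : ETerm n) : ETerm n
  | succ {n : ℕ} (M : ETerm n) : ETerm n
  | ifz {n : ℕ} (L M N : ETerm n) : ETerm n
  | fix {n : ℕ} (M : ETerm n) : ETerm n

/-- Explicit substitutions `[z₁ ← (σ₁, M₁), …, zₘ ← (σₘ, Mₘ)]`, where the free variables of each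
`Mᵢ` are in `dom σᵢ`; `snoc σ ρ N` is `σ + [z ← (ρ, N)]`. -/
inductive ESubst : ℕ → Type
  | nil : ESubst 0
  | snoc {m k : ℕ} (σ : ESubst m) (ρ : ESubst k) (N : ETerm k) : ESubst (m + 1)
end

/-- `some k` if the term is the numeral `succᵏ(0)`, and `none` if it is not a numeral. -/
def ETerm.numeral? : {n : ℕ} → ETerm n → Option ℕ
  | _, .zero => some 0
  | _, .succ M => M.numeral?.map (· + 1)
  | _, _ => none

mutual
/-- The translation of a term with respect to the variables `x₁, …, xₙ`. For numerals, the clause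
for numerals takes precedence over the one for `succ`. -/
def ETerm.trans {A : Type*} (t : AddressTable A) : {n : ℕ} → ETerm n → EAM A
  | n, .var i => EAM.proj A n i.rev
  | _, .lam σ M => (M.trans t).append (σ.addrs t)
  | n, .app M N => (EAM.apply A n).append [t.addr (M.trans t), t.addr (N.trans t)]
  | n, .zero => (EAM.proj A (n + 1) 0).append [t.num 0]
  | n, .pred M => (EAM.predecessor A n).append [t.addr (M.trans t)]
  | n, .succ M =>
    match M.numeral? with
    | some k => (EAM.proj A (n + 1) 0).append [t.num (k + 1)]
    | none => (EAM.successor A n).append [t.addr (M.trans t)]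
  | n, .ifz L M N =>
    (EAM.ifZero A n).append [t.addr (L.trans t), t.addr (M.trans t), t.addr (N.trans t)]
  | n, .fix M => (t.fixMachine n).append [t.addr (M.trans t)]

/-- The addresses of the translated closures of an explicit substitution. The translation of the
pair `(ρ, N)` with respect to variables `x₁, …, xₙ` is the translation of `N` with respect to
`z₁, …, zₖ, x₁, …, xₙ`, where `dom ρ = {z₁, …, zₖ}`, whose tape is extended by these addresses. -/
def ESubst.addrs {A : Type*} (t : AddressTable A) : {m : ℕ} → ESubst m → List A
  | _, .nil => []
  | _, .snoc σ ρ N => σ.addrs t ++ [t.addr ((N.trans t).append (ρ.addrs t))]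
end

/-! PCF. -/

/-- Simple types over the ground type `int`. -/
inductive Ty : Type
  | int
  | arrow (α β : Ty)

/-- PCF terms up to renaming of bound variables, with `n` free variables, in de Bruijn notation.
The elements of `PCF 0` are the closed terms, i.e. the programs. -/
inductive PCF : ℕ → Type
  | var {n : ℕ} (i : Fin n) : PCF n
  | app {n : ℕ} (P Q : PCF n) : PCF n
  | lam {n : ℕ} (P : PCF (n + 1)) : PCF n
  | zero {n : ℕ} : PCF n
  | pred {n : ℕ} (P : PCF n) : PCF n
  | succ {n : ℕ} (P : PCF n) : PCF n
  | ifz {n : ℕ} (P Q Q' : PCF n) : PCF n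
  | fix {n : ℕ} (P : PCF n) : PCF n

namespace PCF

/-- Renaming of variables. -/
def rename : {n m : ℕ} → (Fin n → Fin m) → PCF n → PCF m
  | _, _, f, .var i => .var (f i)
  | _, _, f, .app P Q => .app (P.rename f) (Q.rename f)
  | _, _, f, .lam P => .lam (P.rename (Fin.cases 0 fun i => (f i).succ))
  | _, _, _, .zero => .zero
  | _, _, f, .pred P => .pred (P.rename f)
  | _, _, f, .succ P => .succ (P.rename f)
  | _, _, f, .ifz P Q Q' => .ifz (P.rename f) (Q.rename f) (Q'.rename f)
  | _, _, f, .fix P => .fix (P.rename f)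

/-- Simultaneous capture-free substitution. -/
def subst : {n m : ℕ} → (Fin n → PCF m) → PCF n → PCF m
  | _, _, s, .var i => s i
  | _, _, s, .app P Q => .app (P.subst s) (Q.subst s)
  | _, _, s, .lam P => .lam (P.subst (Fin.cases (.var 0) fun i => (s i).rename Fin.succ))
  | _, _, _, .zero => .zero
  | _, _, s, .pred P => .pred (P.subst s)
  | _, _, s, .succ P => .succ (P.subst s)
  | _, _, s, .ifz P Q Q' => .ifz (P.subst s) (Q.subst s) (Q'.subst s)
  | _, _, s, .fix P => .fix (P.subst s)

/-- `P[Q/x]`, where `x` is the variable with index `0`. -/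
def inst {n : ℕ} (P : PCF (n + 1)) (Q : PCF n) : PCF n :=
  P.subst (Fin.cases Q .var)

/-- The numeral `succᵏ(0)`. -/
def numeral {n : ℕ} : ℕ → PCF n
  | 0 => .zero
  | k + 1 => .succ (numeral k)

/-- Values: abstractions and numerals. -/
inductive IsValue {n : ℕ} : PCF n → Prop
  | lam (P : PCF (n + 1)) : IsValue (.lam P)
  | numeral (k : ℕ) : IsValue (numeral k)

/-- The call-by-name big-step semantics `P ⇓ U`. -/
inductive Eval {n : ℕ} : PCF n → PCF n → Prop
  | val {U} : IsValue U → Eval U U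
  | pred_zero {P} : Eval P (numeral 0) → Eval (.pred P) (numeral 0)
  | pred_succ {P k} : Eval P (numeral (k + 1)) → Eval (.pred P) (numeral k)
  | succ {P k} : Eval P (numeral k) → Eval (.succ P) (numeral (k + 1))
  | ifz_zero {P Q Q' U} : Eval P (numeral 0) → Eval Q U → Eval (.ifz P Q Q') U
  | ifz_succ {P Q Q' U k} : Eval P (numeral (k + 1)) → Eval Q' U → Eval (.ifz P Q Q') U
  | fix {P U} : Eval (.app P (.fix P)) U → Eval (.fix P) U
  | beta {P P' Q U} : Eval P (.lam P') → Eval (P'.inst Q) U → Eval (.app P Q) U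

/-- The typing judgement `Γ ⊢ P : α`. -/
inductive HasType : {n : ℕ} → (Fin n → Ty) → PCF n → Ty → Prop
  | var {n} {Γ : Fin n → Ty} (i : Fin n) : HasType Γ (.var i) (Γ i)
  | lam {n} {Γ : Fin n → Ty} {P α β} :
      HasType (Fin.cases α Γ : Fin (n + 1) → Ty) P β → HasType Γ (.lam P) (.arrow α β)
  | app {n} {Γ : Fin n → Ty} {P Q α β} :
      HasType Γ P (.arrow α β) → HasType Γ Q α → HasType Γ (.app P Q) β
  | zero {n} {Γ : Fin n → Ty} : HasType Γ .zero .int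
  | pred {n} {Γ : Fin n → Ty} {P} : HasType Γ P .int → HasType Γ (.pred P) .int
  | succ {n} {Γ : Fin n → Ty} {P} : HasType Γ P .int → HasType Γ (.succ P) .int
  | ifz {n} {Γ : Fin n → Ty} {P Q Q' α} :
      HasType Γ P .int → HasType Γ Q α → HasType Γ Q' α → HasType Γ (.ifz P Q Q') α
  | fix {n} {Γ : Fin n → Ty} {P α} : HasType Γ P (.arrow α α) → HasType Γ (.fix P) α

/-- PCF terms are the EPCF terms all of whose explicit substitutions are empty. -/
def toETerm : {n : ℕ} → PCF n → ETerm n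
  | _, .var i => .var i
  | _, .app P Q => .app P.toETerm Q.toETerm
  | _, .lam P => .lam .nil P.toETerm
  | _, .zero => .zero
  | _, .pred P => .pred P.toETerm
  | _, .succ P => .succ P.toETerm
  | _, .ifz P Q Q' => .ifz P.toETerm Q.toETerm Q'.toETerm
  | _, .fix P => .fix P.toETerm

end PCF

/-! The proof relates addresses of machines to programs by `AddressTable.Realizes`: the translation
of an open term `M` realizes `M[s]` once its tape has been filled with addresses realizing the
terms substituted by `s`, and `a · b` realizes `P · Q` if `a` realizes `P` and `b` realizes `Q`.
Thus the machines keep as pending tapes the substitutions which the big-step semantics performs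
at once, and no machine equation between `|P'|_y @ [#|Q|]` and `|P'[Q/y]|` is needed.

By induction on `P ⇓ U`, every address realizing `P` behaves like `U`
(`AddressTable.Realizes.behaves`): its machine reduces to the numeral machine of `n` if `U` is the
numeral of `n`; if `U` is an abstraction `λx.P'`, then applying the machine to an address realizing
`Q` yields, after some steps, a machine whose address realizes `P'[Q/x]`. Each evaluation rule is
matched by running the corresponding combinator machine. Including application addresses in the
relation is what makes the rule for `fix` go through, since `Y_n` calls the machine with address
`#|P| · #|fix P|` directly and not the translation of `P · fix P`. Types play no role. -/

/-! ### Substitution in PCF -/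

namespace PCF

/-- The extension of a renaming under a binder. -/
def liftRen {n m : ℕ} (f : Fin n → Fin m) : Fin (n + 1) → Fin (m + 1) :=
  Fin.cases 0 fun i => (f i).succ

/-- The extension of a substitution under a binder. -/
def liftSubst {n m : ℕ} (s : Fin n → PCF m) : Fin (n + 1) → PCF (m + 1) :=
  Fin.cases (.var 0) fun i => (s i).rename Fin.succ

theorem rename_lam {n m : ℕ} (f : Fin n → Fin m) (P : PCF (n + 1)) :
    (lam P).rename f = lam (P.rename (liftRen f)) := rfl

theorem subst_lam {n m : ℕ} (s : Fin n → PCF m) (P : PCF (n + 1)) :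
    (lam P).subst s = lam (P.subst (liftSubst s)) := rfl

theorem rename_rename {n m k : ℕ} (f : Fin n → Fin m) (g : Fin m → Fin k) (P : PCF n) :
    (P.rename f).rename g = P.rename (g ∘ f) := by
  induction P generalizing m k with
  | lam P ih =>
    rw [rename_lam, rename_lam, rename_lam, ih]
    congr 2
    funext i
    cases i using Fin.cases <;> rfl
  | _ => simp_all [rename]

theorem subst_rename {n m k : ℕ} (f : Fin n → Fin m) (s : Fin m → PCF k) (P : PCF n) :
    (P.rename f).subst s = P.subst (s ∘ f) := by
  induction P generalizing m k with
  | lam P ih =>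
    rw [rename_lam, subst_lam, subst_lam, ih]
    congr 2
    funext i
    cases i using Fin.cases <;> rfl
  | _ => simp_all [rename, subst]

theorem rename_subst {n m k : ℕ} (s : Fin n → PCF m) (f : Fin m → Fin k) (P : PCF n) :
    (P.subst s).rename f = P.subst fun i => (s i).rename f := by
  induction P generalizing m k with
  | lam P ih =>
    rw [subst_lam, rename_lam, subst_lam, ih]
    congr 2
    funext i
    cases i using Fin.cases with
    | zero => rfl
    | succ i => simp only [liftSubst, Fin.cases_succ, rename_rename]; rfl
  | _ => simp_all [rename, subst]

theorem subst_subst {n m k : ℕ} (s : Fin n → PCF m) (u : Fin m → PCF k) (P : PCF n) :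
    (P.subst s).subst u = P.subst fun i => (s i).subst u := by
  induction P generalizing m k with
  | lam P ih =>
    rw [subst_lam, subst_lam, subst_lam, ih]
    congr 2
    funext i
    cases i using Fin.cases with
    | zero => rfl
    | succ i => simp only [liftSubst, Fin.cases_succ, rename_subst, subst_rename]; rfl
  | _ => simp_all [subst]

theorem subst_var {n : ℕ} (P : PCF n) : P.subst var = P := by
  have lift_var : ∀ n, liftSubst (var : Fin n → PCF n) = var := fun n => by
    funext i
    cases i using Fin.cases <;> rfl
  induction P with
  | lam P ih => rw [subst_lam, lift_var, ih]
  | _ => simp_all [subst]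

theorem inst_subst_liftSubst {n m : ℕ} (s : Fin n → PCF m) (P : PCF (n + 1)) (Q : PCF m) :
    (P.subst (liftSubst s)).inst Q = P.subst (Fin.cons Q s) := by
  rw [inst, subst_subst]
  congr 1
  funext i
  cases i using Fin.cases with
  | zero => rfl
  | succ i =>
    simp only [liftSubst, Fin.cases_succ, subst_rename, Fin.cons_succ]
    exact subst_var _

/-! ### Numerals -/

theorem subst_numeral {n m : ℕ} (s : Fin n → PCF m) (k : ℕ) :
    (numeral k : PCF n).subst s = numeral k := by
  induction k with
  | zero => rfl
  | succ k ih => simp [numeral, subst, ih]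

theorem numeral_injective {n : ℕ} : Function.Injective (numeral : ℕ → PCF n) := by
  intro k l h
  induction k generalizing l with
  | zero => cases l <;> simp_all [numeral]
  | succ k ih =>
    cases l with
    | zero => simp [numeral] at h
    | succ l =>
      simp only [numeral, succ.injEq] at h
      rw [ih h]

theorem numeral_ne_lam {n k : ℕ} {P : PCF (n + 1)} : numeral k ≠ lam P := by
  cases k <;> simp [numeral]

theorem Eval.numeral_eq {n k : ℕ} {U : PCF n} (h : Eval (.numeral k) U) : U = .numeral k := by
  induction k generalizing U with
  | zero => cases h; rfl
  | succ k ih =>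
    cases h with
    | val => rfl
    | succ h => rw [numeral, numeral, ← ih h]

theorem eq_numeral_of_numeral? {n : ℕ} {P : PCF n} {k : ℕ} (h : P.toETerm.numeral? = some k) :
    P = numeral k := by
  induction P generalizing k with
  | zero =>
    simp only [toETerm, ETerm.numeral?, Option.some.injEq] at h
    rw [← h, numeral]
  | succ P ih =>
    simp only [toETerm, ETerm.numeral?, Option.map_eq_some_iff] at h
    obtain ⟨l, hl, rfl⟩ := h
    rw [numeral, ← ih hl]
  | _ => simp [toETerm, ETerm.numeral?] at h

end PCF

/-! ### Running programs -/

theorem EAM.append_append {A : Type*} (M : EAM A) (S T : List A) :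
    (M.append S).append T = M.append (S ++ T) := by
  simp [EAM.append]

theorem EAM.append_nil {A : Type*} (M : EAM A) : M.append [] = M := by
  simp [EAM.append]

theorem Holds.lt_length {A : Type*} {R : List (Option A)} {i : ℕ} {a : A} (h : Holds R i a) :
    i < R.length :=
  (List.getElem?_eq_some_iff.1 h).1

theorem initialised_set {A : Type*} {R : List (Option A)} {i : ℕ} (hi : i < R.length) (a : A) :
    initialised (R.set i (some a)) = insert i (initialised R) := by
  ext j
  by_cases h : i = j
  · subst h
    simp [initialised, Holds, hi]
  · simp [initialised, Holds, h, Ne.symm h]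

theorem initialised_set_of_holds {A : Type*} {R : List (Option A)} {i : ℕ} {a : A}
    (h : Holds R i a) (b : A) : initialised (R.set i (some b)) = initialised R := by
  rw [initialised_set h.lt_length]
  exact Set.insert_eq_of_mem ⟨a, h⟩

/-- The registers following an initial segment `R` hold the entries of `l`, in the form in which a
block of `App` instructions reads them. -/
theorem forall₂_holds_range' {A : Type*} (R : List (Option A)) (l : List A) :
    List.Forall₂ (Holds (R ++ l.map some)) (List.range' R.length l.length) l := by
  rw [List.forall₂_iff_get]
  refine ⟨by simp, fun i h₁ h₂ => ?_⟩
  simp only [List.length_range'] at h₁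
  simp [Holds, h₁]

namespace AddressTable

variable {A : Type*} (t : AddressTable A)

theorem lookup_addr (M : EAM A) : t.lookup (t.addr M) = M := t.addr.symm_apply_apply M

theorem addr_lookup (a : A) : t.addr (t.lookup a) = a := t.addr.apply_symm_apply a

theorem lookup_num (n : ℕ) : t.lookup (t.num n) = t.numeral n := by
  rw [← t.addr_numeral, lookup_addr, numeral]

theorem lookup_num_isFinal (n : ℕ) : (t.lookup (t.num n)).IsFinal := by
  rw [lookup_num]
  exact Or.inl rfl

theorem lookup_appAddr (a b : A) : t.lookup (t.appAddr a b) = (t.lookup a).append [b] :=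
  t.lookup_addr _

theorem foldl_appAddr (a : A) (l : List A) :
    l.foldl t.appAddr a = t.addr ((t.lookup a).append l) := by
  induction l generalizing a with
  | nil => simp [EAM.append_nil, addr_lookup]
  | cons b l ih => rw [List.foldl_cons, ih, lookup_appAddr, EAM.append_append]; rfl

variable {t}

/-- Every step of a machine can also be made with a longer tape. -/
theorem Step.append {M N : EAM A} (h : t.Step M (.mach N)) (T : List A) :
    t.Step (M.append T) (.mach (N.append T)) := by
  cases h with
  | call hi => simp only [EAM.append_append]; exact .call hi
  | load => exact .load
  | app hi hj => exact .app hi hj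
  | pred hi hf => exact .pred hi hf
  | pred_run hi hs => exact .pred_run hi hs
  | succ hi hf => exact .succ hi hf
  | succ_run hi hs => exact .succ_run hi hs
  | test_zero hi hj hf => exact .test_zero hi hj hf
  | test_pos hi hj hf => exact .test_pos hi hj hf
  | test_run hi hs => exact .test_run hi hs

theorem Reduces.append {M N : EAM A} (h : t.Reduces M N) (T : List A) :
    t.Reduces (M.append T) (N.append T) :=
  Relation.ReflTransGen.lift (EAM.append · T) (fun _ _ h => Step.append h T) _ _ h

theorem Reduces.trans {L M N : EAM A} (h : t.Reduces L M) (h' : t.Reduces M N) : t.Reduces L N :=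
  Relation.ReflTransGen.trans h h'

theorem Step.reduces {M N : EAM A} (h : t.Step M (.mach N)) : t.Reduces M N :=
  Relation.ReflTransGen.single h

/-- The machine `N` is reached by running the body `P` on registers `R` and tape `T`. Quantifying
over the proof of validity of the source keeps it out of the way when programs are run
instruction by instruction. -/
def Runs (t : AddressTable A) (R : List (Option A)) (P : AProg) (T : List A) (N : EAM A) : Prop :=
  ∀ h, t.Reduces ⟨R, .body P, T, h⟩ N

/-- A block of `Load` instructions moves the tape into the uninitialised registers. -/
theorem reduces_loads {P : AProg} {T : List A} {N : EAM A} (l : List A) (R : List (Option A))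
    (hN : t.Runs (R ++ l.map some) P T N) (h) :
    t.Reduces ⟨R ++ List.replicate l.length none, loads (List.range' R.length l.length) P,
      l ++ T, h⟩ N := by
  induction l generalizing R with
  | nil => simp only [List.map_nil, List.length_nil] at *; exact hN h
  | cons a l ih =>
    have e : (R ++ List.replicate (l.length + 1) none).set R.length (some a)
        = (R ++ [some a]) ++ List.replicate l.length none := by
      simp [List.replicate_succ]
    have hv : (loads (List.range' (R.length + 1) l.length) P).Valid
        ((R ++ List.replicate (l.length + 1) none).set R.length (some a)).length
        (initialised ((R ++ List.replicate (l.length + 1) none).set R.length (some a))) := by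
      rw [initialised_set (by simp), List.length_set]
      rcases h with h | h
      · exact h.2
      · simp at h
    refine (Step.reduces (.load (h' := hv))).trans ?_
    have := ih (R ++ [some a]) (by simpa using hN)
    simp only [List.length_append, List.length_singleton, ← e] at this
    exact this hv

theorem Runs.app {R : List (Option A)} {i j k : ℕ} {a b : A} {P : AProg} {T : List A} {N : EAM A}
    (hi : Holds R i a) (hj : Holds R j b)
    (hN : t.Runs (R.set k (some (t.appAddr a b))) P T N) : t.Runs R (.app i j k P) T N := by
  intro h
  have hv : P.Valid (R.set k (some (t.appAddr a b))).length
      (initialised (R.set k (some (t.appAddr a b)))) := by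
    rw [initialised_set h.2.2.1, List.length_set]
    exact h.2.2.2
  exact (Step.reduces (.app (h' := hv) hi hj)).trans (hN hv)

/-- The block `App i j₁ i; …; App i jₖ i` extends the tape of the machine addressed by register `i`
by the addresses in registers `j₁, …, jₖ`. -/
theorem Runs.apps {R : List (Option A)} {i : ℕ} {a : A} {js : List ℕ} {l : List A} {P : AProg}
    {T : List A} {N : EAM A} (hi : Holds R i a) (hj : List.Forall₂ (Holds R) js l) (hij : i ∉ js)
    (hN : t.Runs (R.set i (some (t.addr ((t.lookup a).append l)))) P T N) :
    t.Runs R (apps i js P) T N := by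
  rw [← foldl_appAddr] at hN
  induction js generalizing R a l with
  | nil =>
    cases hj
    have : R.set i (some a) = R := by
      obtain ⟨h, e⟩ := List.getElem?_eq_some_iff.1 hi
      rw [← e, List.set_getElem_self]
    rwa [List.foldl_nil, this] at hN
  | cons j js ih =>
    obtain ⟨b, l, hb, hl, rfl⟩ := List.forall₂_cons_left_iff.1 hj
    simp only [List.mem_cons, not_or] at hij
    refine Runs.app hi hb (ih (a := t.appAddr a b) (l := l) ?_ ?_ hij.2 ?_)
    · simp [Holds, hi.lt_length]
    · refine List.forall₂_iff_get.2 ⟨hl.length_eq, fun k h₁ h₂ => ?_⟩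
      have hne : i ≠ js.get ⟨k, h₁⟩ := fun e => hij.2 (e ▸ List.get_mem _ _)
      have := (List.forall₂_iff_get.1 hl).2 k h₁ h₂
      simpa only [Holds, List.getElem?_set_ne hne] using this
    · simpa using hN

theorem Runs.call {R : List (Option A)} {i : ℕ} {a : A} {T : List A} (hi : Holds R i a) :
    t.Runs R (.last (.call i)) T ((t.lookup a).append T) :=
  fun _ => Step.reduces (.call hi)

/-- An instruction which first runs the machine addressed by register `i` to the end may be treated
as if that machine had been run beforehand. -/
theorem Runs.of_reduces {R : List (Option A)} {i : ℕ} {a b : A} {P : AProg} {T : List A} {N : EAM A}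
    (hstep : ∀ {R : List (Option A)} {a : A} {M : EAM A} (h h'), Holds R i a →
      t.Step (t.lookup a) (.mach M) →
      t.Step ⟨R, .body P, T, h⟩ (.mach ⟨R.set i (some (t.addr M)), .body P, T, h'⟩))
    (hi : Holds R i a) (hab : t.Reduces (t.lookup a) (t.lookup b))
    (hN : t.Runs (R.set i (some b)) P T N) : t.Runs R P T N := by
  obtain ⟨M, hM⟩ : ∃ M, M = t.lookup a := ⟨_, rfl⟩
  rw [← hM] at hab
  induction hab using Relation.ReflTransGen.head_induction_on generalizing R a with
  | refl =>
    have hba : b = a := t.addr.symm.injective hM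
    have : R.set i (some b) = R := by
      obtain ⟨h, e⟩ := List.getElem?_eq_some_iff.1 hi
      rw [hba, ← e, List.set_getElem_self]
    rwa [this] at hN
  | @head M M' hs _ ih =>
    subst hM
    intro h
    have hv : P.Valid (R.set i (some (t.addr M'))).length
        (initialised (R.set i (some (t.addr M')))) := by
      rw [initialised_set_of_holds hi, List.length_set]
      exact h
    refine (Step.reduces (hstep h hv hi hs)).trans (ih ?_ ?_ (t.lookup_addr M').symm hv)
    · simp [Holds, hi.lt_length]
    · simpa using hN

theorem Runs.pred {R : List (Option A)} {i j n : ℕ} {a : A} {P : AProg} {T : List A} {N : EAM A}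
    (hi : Holds R i a) (ha : t.Reduces (t.lookup a) (t.numeral n))
    (hN : t.Runs ((R.set i (some (t.num n))).set j (some (t.num (n - 1)))) P T N) :
    t.Runs R (.pred i j P) T N := by
  rw [← lookup_num] at ha
  refine Runs.of_reduces (fun h h' => .pred_run) hi ha fun h => ?_
  have hv : P.Valid ((R.set i (some (t.num n))).set j (some (t.num (n - 1)))).length
      (initialised ((R.set i (some (t.num n))).set j (some (t.num (n - 1))))) := by
    rw [initialised_set h.2.1, List.length_set]
    exact h.2.2
  refine (Step.reduces (.pred (h' := hv) ?_ (t.lookup_num_isFinal n))).trans (hN hv)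
  simp [Holds, hi.lt_length]

theorem Runs.succ {R : List (Option A)} {i j n : ℕ} {a : A} {P : AProg} {T : List A} {N : EAM A}
    (hi : Holds R i a) (ha : t.Reduces (t.lookup a) (t.numeral n))
    (hN : t.Runs ((R.set i (some (t.num n))).set j (some (t.num (n + 1)))) P T N) :
    t.Runs R (.succ i j P) T N := by
  rw [← lookup_num] at ha
  refine Runs.of_reduces (fun h h' => .succ_run) hi ha fun h => ?_
  have hv : P.Valid ((R.set i (some (t.num n))).set j (some (t.num (n + 1)))).length
      (initialised ((R.set i (some (t.num n))).set j (some (t.num (n + 1))))) := by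
    rw [initialised_set h.2.1, List.length_set]
    exact h.2.2
  refine (Step.reduces (.succ (h' := hv) ?_ (t.lookup_num_isFinal n))).trans (hN hv)
  simp [Holds, hi.lt_length]

theorem Runs.test_zero {R : List (Option A)} {i j k l : ℕ} {a b : A} {P : AProg} {T : List A}
    {N : EAM A} (hi : Holds R i a) (ha : t.Reduces (t.lookup a) (t.numeral 0))
    (hj : Holds R j b) (hij : i ≠ j)
    (hN : t.Runs ((R.set i (some (t.num 0))).set l (some b)) P T N) :
    t.Runs R (.test i j k l P) T N := by
  rw [← lookup_num] at ha
  refine Runs.of_reduces (fun h h' => .test_run) hi ha fun h => ?_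
  have hv : P.Valid ((R.set i (some (t.num 0))).set l (some b)).length
      (initialised ((R.set i (some (t.num 0))).set l (some b))) := by
    rw [initialised_set h.2.2.2.1, List.length_set]
    exact h.2.2.2.2
  refine (Step.reduces (.test_zero (h' := hv) ?_ ?_ (t.lookup_num_isFinal 0))).trans (hN hv)
  · simp [Holds, hi.lt_length]
  · rwa [Holds, List.getElem?_set_ne hij]

theorem Runs.test_pos {R : List (Option A)} {i j k l n : ℕ} {a b : A} {P : AProg} {T : List A}
    {N : EAM A} (hi : Holds R i a) (ha : t.Reduces (t.lookup a) (t.numeral (n + 1)))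
    (hk : Holds R k b) (hik : i ≠ k)
    (hN : t.Runs ((R.set i (some (t.num (n + 1)))).set l (some b)) P T N) :
    t.Runs R (.test i j k l P) T N := by
  rw [← lookup_num] at ha
  refine Runs.of_reduces (fun h h' => .test_run) hi ha fun h => ?_
  have hv : P.Valid ((R.set i (some (t.num (n + 1)))).set l (some b)).length
      (initialised ((R.set i (some (t.num (n + 1)))).set l (some b))) := by
    rw [initialised_set h.2.2.2.1, List.length_set]
    exact h.2.2.2.2
  refine (Step.reduces (.test_pos (n := n) (h' := hv) ?_ ?_ (t.lookup_num_isFinal _))).trans (hN hv)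
  · simp [Holds, hi.lt_length]
  · rwa [Holds, List.getElem?_set_ne hik]

/-! ### The combinator machines -/

/-- The form of `reduces_loads` applicable to machines given only up to the equality of their
components. -/
theorem reduces_of_loads {M N : EAM A} {P : AProg} {T : List A} (l : List A) (R : List (Option A))
    (hr : M.regs = R ++ List.replicate l.length none)
    (hp : M.prog = loads (List.range' R.length l.length) P) (ht : M.tape = l ++ T)
    (hN : t.Runs (R ++ l.map some) P T N) : t.Reduces M N := by
  obtain ⟨_, _, _, h⟩ := M
  cases hr
  cases hp
  cases ht
  exact reduces_loads l R hN h

theorem reduces_proj {n : ℕ} {i : Fin n} {a : A} {l : List A} (hl : l.length = n)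
    (h : l[(i : ℕ)]? = some a) : t.Reduces ((EAM.proj A n i).append l) (t.lookup a) := by
  subst hl
  rw [← EAM.append_nil (t.lookup a)]
  refine reduces_of_loads (T := []) l [] rfl ?_ (by simp [EAM.append, EAM.proj])
    (Runs.call (i := i) (by rw [Holds, List.nil_append, List.getElem?_map, h]; rfl))
  simp [EAM.append, EAM.proj, List.range_eq_range']

theorem reduces_apply {n : ℕ} (a b : A) {l : List A} (hl : l.length = n) :
    t.Reduces ((EAM.apply A n).append (a :: b :: l))
      (((t.lookup a).append l).append [t.addr ((t.lookup b).append l)]) := by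
  subst hl
  rw [← t.lookup_addr ((t.lookup a).append l), ← lookup_appAddr, ← EAM.append_nil (t.lookup _)]
  refine reduces_of_loads (T := []) (a :: b :: l) [] rfl ?_ (by simp [EAM.append, EAM.apply])
    (Runs.apps (i := 0) (a := a) rfl (forall₂_holds_range' [some a, some b] l) (by simp)
    (Runs.apps (i := 1) (a := b) rfl (forall₂_holds_range' [some _, some b] l) (by simp)
    (Runs.app (k := 0) (i := 0) (j := 1) rfl rfl (Runs.call (i := 0) rfl))))
  simp [EAM.append, EAM.apply, List.range_eq_range']

/-- Since register `0` holds the address of `Y_n` itself, the machine rebuilds the address of its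
own closure and passes it to the called one. -/
theorem reduces_fixMachine {n : ℕ} (a : A) {l : List A} (hl : l.length = n) :
    t.Reduces ((t.fixMachine n).append (a :: l))
      (((t.lookup a).append l).append [t.addr ((t.fixMachine n).append (a :: l))]) := by
  subst hl
  have hY : t.lookup (t.fixAddr l.length) = t.fixMachine l.length := by
    rw [← t.addr_fixpt, lookup_addr, fixMachine]
  have key : t.Reduces ((t.fixMachine l.length).append (a :: l))
      ((t.lookup (t.appAddr (t.addr ((t.lookup a).append l))
        (t.addr ((t.lookup (t.fixAddr l.length)).append (a :: l))))).append []) := by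
    refine reduces_of_loads (T := []) (a :: l) [some (t.fixAddr l.length)] rfl ?_
      (by simp [EAM.append, fixMachine, EAM.fixpt])
      (Runs.apps (i := 0) rfl (forall₂_holds_range' [some _] (a :: l)) (by simp)
      (Runs.apps (i := 1) (a := a) rfl (forall₂_holds_range' [some _, some a] l) (by simp)
      (Runs.app (k := 1) (i := 1) (j := 0) rfl rfl (Runs.call (i := 1) rfl))))
    simp [EAM.append, fixMachine, EAM.fixpt]
  rwa [EAM.append_nil, lookup_appAddr, hY, lookup_addr] at key

theorem reduces_predecessor {n k : ℕ} {a : A} {l : List A} (hl : l.length = n)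
    (h : t.Reduces ((t.lookup a).append l) (t.numeral k)) :
    t.Reduces ((EAM.predecessor A n).append (a :: l)) (t.numeral (k - 1)) := by
  subst hl
  rw [← lookup_num, ← EAM.append_nil (t.lookup _)]
  rw [← t.lookup_addr ((t.lookup a).append l)] at h
  refine reduces_of_loads (T := []) (a :: l) [] rfl ?_ (by simp [EAM.append, EAM.predecessor])
    (Runs.apps (i := 0) (a := a) rfl (forall₂_holds_range' [some a] l) (by simp)
    (Runs.pred (i := 0) (j := 0) rfl h (Runs.call (i := 0) rfl)))
  simp [EAM.append, EAM.predecessor, List.range_eq_range']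

theorem reduces_successor {n k : ℕ} {a : A} {l : List A} (hl : l.length = n)
    (h : t.Reduces ((t.lookup a).append l) (t.numeral k)) :
    t.Reduces ((EAM.successor A n).append (a :: l)) (t.numeral (k + 1)) := by
  subst hl
  rw [← lookup_num, ← EAM.append_nil (t.lookup _)]
  rw [← t.lookup_addr ((t.lookup a).append l)] at h
  refine reduces_of_loads (T := []) (a :: l) [] rfl ?_ (by simp [EAM.append, EAM.successor])
    (Runs.apps (i := 0) (a := a) rfl (forall₂_holds_range' [some a] l) (by simp)
    (Runs.succ (i := 0) (j := 0) rfl h (Runs.call (i := 0) rfl)))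
  simp [EAM.append, EAM.successor, List.range_eq_range']

theorem reduces_ifZero_zero {n : ℕ} {a b c : A} {l : List A} (hl : l.length = n)
    (h : t.Reduces ((t.lookup a).append l) (t.numeral 0)) :
    t.Reduces ((EAM.ifZero A n).append (a :: b :: c :: l)) ((t.lookup b).append l) := by
  subst hl
  rw [← t.lookup_addr ((t.lookup b).append l), ← EAM.append_nil (t.lookup (t.addr _))]
  rw [← t.lookup_addr ((t.lookup a).append l)] at h
  refine reduces_of_loads (T := []) (a :: b :: c :: l) [] rfl ?_
    (by simp [EAM.append, EAM.ifZero])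
    (Runs.apps (i := 0) (a := a) rfl (forall₂_holds_range' [some a, some b, some c] l) (by simp)
    (Runs.apps (i := 1) (a := b) rfl (forall₂_holds_range' [some _, some b, some c] l) (by simp)
    (Runs.apps (i := 2) (a := c) rfl (forall₂_holds_range' [some _, some _, some c] l) (by simp)
    (Runs.test_zero (i := 0) (j := 1) (k := 2) (l := 0) rfl h rfl (by simp)
      (Runs.call (i := 0) rfl)))))
  simp [EAM.append, EAM.ifZero, List.range_eq_range']

theorem reduces_ifZero_pos {n k : ℕ} {a b c : A} {l : List A} (hl : l.length = n)
    (h : t.Reduces ((t.lookup a).append l) (t.numeral (k + 1))) :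
    t.Reduces ((EAM.ifZero A n).append (a :: b :: c :: l)) ((t.lookup c).append l) := by
  subst hl
  rw [← t.lookup_addr ((t.lookup c).append l), ← EAM.append_nil (t.lookup (t.addr _))]
  rw [← t.lookup_addr ((t.lookup a).append l)] at h
  refine reduces_of_loads (T := []) (a :: b :: c :: l) [] rfl ?_
    (by simp [EAM.append, EAM.ifZero])
    (Runs.apps (i := 0) (a := a) rfl (forall₂_holds_range' [some a, some b, some c] l) (by simp)
    (Runs.apps (i := 1) (a := b) rfl (forall₂_holds_range' [some _, some b, some c] l) (by simp)
    (Runs.apps (i := 2) (a := c) rfl (forall₂_holds_range' [some _, some _, some c] l) (by simp)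
    (Runs.test_pos (i := 0) (j := 1) (k := 2) (l := 0) rfl h rfl (by simp)
      (Runs.call (i := 0) rfl)))))
  simp [EAM.append, EAM.ifZero, List.range_eq_range']

/-! ### The realizability relation -/

/-- The list of the values of an environment in the order `x₁, …, xₙ` in which the translated
machines expect them, the variable with index `0` coming last. -/
def envTape {n : ℕ} (e : Fin n → A) : List A :=
  (List.ofFn e).reverse

theorem length_envTape {n : ℕ} (e : Fin n → A) : (envTape e).length = n := by
  simp [envTape]

theorem envTape_cons {n : ℕ} (a : A) (e : Fin n → A) :
    envTape (Fin.cons a e : Fin (n + 1) → A) = envTape e ++ [a] := by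
  simp [envTape]

theorem getElem?_envTape_rev {n : ℕ} (e : Fin n → A) (i : Fin n) :
    (envTape e)[(i.rev : ℕ)]? = some (e i) := by
  have hi : n - 1 - (n - (i + 1)) = (i : ℕ) := by omega
  rw [envTape, List.getElem?_reverse (by simpa using i.rev.isLt)]
  simp [Fin.val_rev, hi]

/-- The machine translating an open term `M`, with the values of the environment `e` appended to
its tape. -/
def closure (t : AddressTable A) {n : ℕ} (M : PCF n) (e : Fin n → A) : EAM A :=
  (M.toETerm.trans t).append (envTape e)

/-- `t.Realizes a P`: the address `a` represents the program `P`, up to substitutions kept as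
pending tapes and up to applications formed by the map `a · b`. -/
inductive Realizes (t : AddressTable A) : A → PCF 0 → Prop
  | closure {n : ℕ} (M : PCF n) (e : Fin n → A) (s : Fin n → PCF 0)
      (he : ∀ i, Realizes t (e i) (s i)) : Realizes t (t.addr (t.closure M e)) (M.subst s)
  | app {a b : A} {P Q : PCF 0} (ha : Realizes t a P) (hb : Realizes t b Q) :
      Realizes t (t.appAddr a b) (.app P Q)

theorem realizes_trans (P : PCF 0) : t.Realizes (t.addr (P.toETerm.trans t)) P := by
  have := Realizes.closure (t := t) P Fin.elim0 PCF.var fun i => i.elim0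
  rwa [PCF.subst_var, AddressTable.closure, envTape, List.ofFn_zero, List.reverse_nil,
    EAM.append_nil] at this

theorem closure_lam {n : ℕ} (M : PCF (n + 1)) (e : Fin n → A) (b : A) :
    (t.closure (.lam M) e).append [b] = t.closure M (Fin.cons b e) := by
  simp only [closure, PCF.toETerm, ETerm.trans, ESubst.addrs, EAM.append_nil,
    EAM.append_append, envTape_cons]

theorem reduces_closure_var {n : ℕ} (i : Fin n) (e : Fin n → A) :
    t.Reduces (t.closure (.var i) e) (t.lookup (e i)) := by
  rw [closure, PCF.toETerm, ETerm.trans]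
  exact reduces_proj (length_envTape e) (getElem?_envTape_rev e i)

theorem reduces_closure_app {n : ℕ} (M N : PCF n) (e : Fin n → A) :
    t.Reduces (t.closure (.app M N) e)
      ((t.closure M e).append [t.addr (t.closure N e)]) := by
  simpa only [closure, PCF.toETerm, ETerm.trans, EAM.append_append, List.cons_append,
    List.nil_append, lookup_addr] using
    reduces_apply (t := t) (t.addr (M.toETerm.trans t)) (t.addr (N.toETerm.trans t))
      (length_envTape e)

theorem reduces_closure_fix {n : ℕ} (M : PCF n) (e : Fin n → A) :
    t.Reduces (t.closure (.fix M) e)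
      ((t.closure M e).append [t.addr (t.closure (.fix M) e)]) := by
  simpa only [closure, PCF.toETerm, ETerm.trans, EAM.append_append, List.cons_append,
    List.nil_append, lookup_addr] using
    reduces_fixMachine (t := t) (t.addr (M.toETerm.trans t)) (length_envTape e)

theorem reduces_closure_pred {n k : ℕ} {M : PCF n} {e : Fin n → A}
    (h : t.Reduces (t.closure M e) (t.numeral k)) :
    t.Reduces (t.closure (.pred M) e) (t.numeral (k - 1)) := by
  simp only [closure, PCF.toETerm, ETerm.trans, EAM.append_append, List.cons_append,
    List.nil_append]
  exact reduces_predecessor (length_envTape e) (by rwa [lookup_addr])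

theorem reduces_closure_succ {n k : ℕ} {M : PCF n} {e : Fin n → A}
    (hM : M.toETerm.numeral? = none) (h : t.Reduces (t.closure M e) (t.numeral k)) :
    t.Reduces (t.closure (.succ M) e) (t.numeral (k + 1)) := by
  simp only [closure, PCF.toETerm, ETerm.trans, hM, EAM.append_append, List.cons_append,
    List.nil_append]
  exact reduces_successor (length_envTape e) (by rwa [lookup_addr])

theorem reduces_closure_zero {n : ℕ} (e : Fin n → A) :
    t.Reduces (t.closure .zero e) (t.numeral 0) := by
  rw [← lookup_num, closure, PCF.toETerm, ETerm.trans, EAM.append_append]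
  exact reduces_proj (by simp [length_envTape]) rfl

theorem reduces_closure_succ_of_numeral? {n k : ℕ} {M : PCF n} (e : Fin n → A)
    (hM : M.toETerm.numeral? = some k) :
    t.Reduces (t.closure (.succ M) e) (t.numeral (k + 1)) := by
  simp only [closure, PCF.toETerm, ETerm.trans, hM, EAM.append_append]
  rw [← lookup_num]
  exact reduces_proj (by simp [length_envTape]) rfl

theorem reduces_closure_ifz_zero {n : ℕ} {L M N : PCF n} {e : Fin n → A}
    (h : t.Reduces (t.closure L e) (t.numeral 0)) :
    t.Reduces (t.closure (.ifz L M N) e) (t.closure M e) := by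
  simp only [closure, PCF.toETerm, ETerm.trans, EAM.append_append, List.cons_append,
    List.nil_append]
  have := reduces_ifZero_zero (t := t) (a := t.addr (L.toETerm.trans t))
    (b := t.addr (M.toETerm.trans t)) (c := t.addr (N.toETerm.trans t)) (length_envTape e)
    (by rwa [lookup_addr])
  rwa [lookup_addr] at this

theorem reduces_closure_ifz_pos {n k : ℕ} {L M N : PCF n} {e : Fin n → A}
    (h : t.Reduces (t.closure L e) (t.numeral (k + 1))) :
    t.Reduces (t.closure (.ifz L M N) e) (t.closure N e) := by
  simp only [closure, PCF.toETerm, ETerm.trans, EAM.append_append, List.cons_append,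
    List.nil_append]
  have := reduces_ifZero_pos (t := t) (a := t.addr (L.toETerm.trans t))
    (b := t.addr (M.toETerm.trans t)) (c := t.addr (N.toETerm.trans t)) (length_envTape e)
    (by rwa [lookup_addr])
  rwa [lookup_addr] at this

/-- Running a machine whose address realizes a program resolves the variable, if the pending term
is one, so that the head constructor of the program becomes visible in the machine. -/
theorem Realizes.exists_head {a : A} {P : PCF 0} (h : t.Realizes a P) :
    (∃ (n : ℕ) (M : PCF n) (e : Fin n → A) (s : Fin n → PCF 0), (∀ i, t.Realizes (e i) (s i)) ∧
      (∀ i, M ≠ .var i) ∧ P = M.subst s ∧ t.Reduces (t.lookup a) (t.closure M e)) ∨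
    ∃ (b c : A) (Q R : PCF 0), t.Realizes b Q ∧ t.Realizes c R ∧ P = .app Q R ∧
      t.Reduces (t.lookup a) ((t.lookup b).append [c]) := by
  induction h with
  | closure M e s he ih =>
    rw [lookup_addr]
    by_cases hM : ∃ i, M = .var i
    · obtain ⟨i, rfl⟩ := hM
      rcases ih i with ⟨n, M, e', s', he', hM, hs, hr⟩ | ⟨b, c, Q, R, hb, hc, hs, hr⟩
      · exact .inl ⟨n, M, e', s', he', hM, hs, (reduces_closure_var i e).trans hr⟩
      · exact .inr ⟨b, c, Q, R, hb, hc, hs, (reduces_closure_var i e).trans hr⟩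
    · exact .inl ⟨_, M, e, s, he, fun i hi => hM ⟨i, hi⟩, rfl, .refl⟩
  | @app a b P Q ha hb =>
    refine .inr ⟨a, b, P, Q, ha, hb, rfl, ?_⟩
    rw [lookup_appAddr]
    exact .refl

theorem Realizes.app_inv {a : A} {P Q : PCF 0} (h : t.Realizes a (.app P Q)) :
    ∃ b c, t.Realizes b P ∧ t.Realizes c Q ∧
      t.Reduces (t.lookup a) ((t.lookup b).append [c]) := by
  rcases h.exists_head with ⟨n, M, e, s, he, hM, hP, hr⟩ | ⟨b, c, _, _, hb, hc, hP, hr⟩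
  · cases M <;> simp [PCF.subst] at hP hM
    obtain ⟨rfl, rfl⟩ := hP
    refine ⟨_, _, .closure _ e s he, .closure _ e s he, hr.trans ?_⟩
    rw [lookup_addr]
    exact reduces_closure_app _ _ e
  · cases hP
    exact ⟨b, c, hb, hc, hr⟩

theorem Realizes.fix_inv {a : A} {P : PCF 0} (h : t.Realizes a (.fix P)) :
    ∃ b, t.Realizes b (.app P (.fix P)) ∧ t.Reduces (t.lookup a) (t.lookup b) := by
  rcases h.exists_head with ⟨n, M, e, s, he, hM, hP, hr⟩ | ⟨_, _, _, _, _, _, hP, _⟩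
  · cases M <;> simp [PCF.subst] at hP hM
    rename_i M
    subst hP
    refine ⟨_, .app (.closure M e s he) (.closure (.fix M) e s he), hr.trans ?_⟩
    rw [lookup_appAddr, lookup_addr]
    exact reduces_closure_fix _ e
  · cases hP

theorem Realizes.lam_inv {a b : A} {P : PCF 1} {Q : PCF 0} (h : t.Realizes a (.lam P))
    (hb : t.Realizes b Q) :
    ∃ c, t.Realizes c (P.inst Q) ∧ t.Reduces ((t.lookup a).append [b]) (t.lookup c) := by
  rcases h.exists_head with ⟨n, M, e, s, he, hM, hP, hr⟩ | ⟨_, _, _, _, _, _, hP, _⟩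
  · cases M with
    | lam M =>
      cases hP
      refine ⟨t.addr (t.closure M (Fin.cons b e)), ?_, ?_⟩
      · have := Realizes.closure (t := t) M (Fin.cons b e) (Fin.cons Q s) fun i => by
          cases i using Fin.cases with
          | zero => exact hb
          | succ i => exact he i
        rwa [← PCF.inst_subst_liftSubst] at this
      · rw [lookup_addr, ← closure_lam]
        exact hr.append [b]
    | _ => simp [PCF.subst] at hP hM
  · cases hP

theorem Realizes.zero_inv {a : A} (h : t.Realizes a .zero) :
    t.Reduces (t.lookup a) (t.numeral 0) := by
  rcases h.exists_head with ⟨n, M, e, s, he, hM, hP, hr⟩ | ⟨_, _, _, _, _, _, hP, _⟩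
  · cases M <;> simp [PCF.subst] at hP hM
    exact hr.trans (reduces_closure_zero e)
  · cases hP

theorem Realizes.pred_inv {a : A} {P : PCF 0} (h : t.Realizes a (.pred P)) :
    ∃ b, t.Realizes b P ∧ ∀ k, t.Reduces (t.lookup b) (t.numeral k) →
      t.Reduces (t.lookup a) (t.numeral (k - 1)) := by
  rcases h.exists_head with ⟨n, M, e, s, he, hM, hP, hr⟩ | ⟨_, _, _, _, _, _, hP, _⟩
  · cases M <;> simp [PCF.subst] at hP hM
    subst hP
    refine ⟨_, .closure _ e s he, fun k hk => hr.trans (reduces_closure_pred ?_)⟩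
    rwa [lookup_addr] at hk
  · cases hP

/-- The second alternative accounts for the special translation of numerals. -/
theorem Realizes.succ_inv {a : A} {P : PCF 0} (h : t.Realizes a (.succ P)) :
    (∃ b, t.Realizes b P ∧ ∀ k, t.Reduces (t.lookup b) (t.numeral k) →
      t.Reduces (t.lookup a) (t.numeral (k + 1))) ∨
    ∃ k, P = .numeral k ∧ t.Reduces (t.lookup a) (t.numeral (k + 1)) := by
  rcases h.exists_head with ⟨n, M, e, s, he, hM, hP, hr⟩ | ⟨_, _, _, _, _, _, hP, _⟩
  · cases M <;> simp [PCF.subst] at hP hM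
    rename_i M
    subst hP
    rcases hk : M.toETerm.numeral? with _ | k
    · refine .inl ⟨_, .closure _ e s he, fun k hb => hr.trans (reduces_closure_succ hk ?_)⟩
      rwa [lookup_addr] at hb
    · refine .inr ⟨k, ?_, hr.trans (reduces_closure_succ_of_numeral? e hk)⟩
      rw [PCF.eq_numeral_of_numeral? hk, PCF.subst_numeral]
  · cases hP

theorem Realizes.ifz_inv {a : A} {P Q Q' : PCF 0} (h : t.Realizes a (.ifz P Q Q')) :
    ∃ b c d, t.Realizes b P ∧ t.Realizes c Q ∧ t.Realizes d Q' ∧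
      (t.Reduces (t.lookup b) (t.numeral 0) → t.Reduces (t.lookup a) (t.lookup c)) ∧
      ∀ k, t.Reduces (t.lookup b) (t.numeral (k + 1)) →
        t.Reduces (t.lookup a) (t.lookup d) := by
  rcases h.exists_head with ⟨n, M, e, s, he, hM, hP, hr⟩ | ⟨_, _, _, _, _, _, hP, _⟩
  · cases M <;> simp [PCF.subst] at hP hM
    obtain ⟨rfl, rfl, rfl⟩ := hP
    refine ⟨_, _, _, .closure _ e s he, .closure _ e s he, .closure _ e s he, ?_⟩
    simp only [lookup_addr]
    exact ⟨fun h => hr.trans (reduces_closure_ifz_zero h),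
      fun k h => hr.trans (reduces_closure_ifz_pos h)⟩
  · cases hP

/-! ### Adequacy -/

/-- The machine `M` behaves like the value `U`: it reduces to the numeral machine if `U` is a
numeral, and, applied to an address realizing `Q`, to a machine realizing the instance `P[Q/x]` of
the body if `U` is an abstraction `λx.P`. -/
structure Behaves (t : AddressTable A) (M : EAM A) (U : PCF 0) : Prop where
  reduces_numeral : ∀ k, U = .numeral k → t.Reduces M (t.numeral k)
  reduces_inst : ∀ P, U = .lam P → ∀ b Q, t.Realizes b Q →
    ∃ c, t.Realizes c (P.inst Q) ∧ t.Reduces (M.append [b]) (t.lookup c)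

theorem Behaves.of_reduces {M N : EAM A} {U : PCF 0} (h : t.Reduces M N) (hN : t.Behaves N U) :
    t.Behaves M U where
  reduces_numeral k hk := h.trans (hN.reduces_numeral k hk)
  reduces_inst P hP b Q hQ := by
    obtain ⟨c, hc, hr⟩ := hN.reduces_inst P hP b Q hQ
    exact ⟨c, hc, (h.append [b]).trans hr⟩

theorem behaves_numeral {M : EAM A} {k : ℕ} (h : t.Reduces M (t.numeral k)) :
    t.Behaves M (.numeral k) where
  reduces_numeral l hl := by rwa [← PCF.numeral_injective hl]
  reduces_inst P hP := absurd hP PCF.numeral_ne_lam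

theorem Realizes.reduces_numeral {a : A} {k : ℕ} (h : t.Realizes a (.numeral k)) :
    t.Reduces (t.lookup a) (t.numeral k) := by
  induction k generalizing a with
  | zero => exact h.zero_inv
  | succ k ih =>
    rcases h.succ_inv with ⟨b, hb, hr⟩ | ⟨l, hl, hr⟩
    · exact hr k (ih hb)
    · rwa [PCF.numeral_injective hl]

/-- Adequacy of the machines for the big-step semantics. -/
theorem Realizes.behaves {a : A} {P U : PCF 0} (hP : P.Eval U) (h : t.Realizes a P) :
    t.Behaves (t.lookup a) U := by
  induction hP generalizing a with
  | val hU =>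
    cases hU with
    | numeral k => exact behaves_numeral h.reduces_numeral
    | lam P =>
      exact ⟨fun k hk => absurd hk.symm PCF.numeral_ne_lam,
        fun P' hP' b Q hb => by cases hP'; exact h.lam_inv hb⟩
  | pred_zero _ ih =>
    obtain ⟨b, hb, hr⟩ := h.pred_inv
    exact behaves_numeral (hr 0 ((ih hb).reduces_numeral 0 rfl))
  | pred_succ _ ih =>
    obtain ⟨b, hb, hr⟩ := h.pred_inv
    exact behaves_numeral (hr _ ((ih hb).reduces_numeral _ rfl))
  | @succ P k hP ih =>
    rcases h.succ_inv with ⟨b, hb, hr⟩ | ⟨l, rfl, hr⟩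
    · exact behaves_numeral (hr k ((ih hb).reduces_numeral k rfl))
    -- The term is syntactically a numeral `succ l`, and `l` evaluates to nothing but itself.
    · rw [PCF.numeral_injective hP.numeral_eq]
      exact behaves_numeral hr
  | ifz_zero _ _ ih₁ ih₂ =>
    obtain ⟨b, c, d, hb, hc, _, hr, _⟩ := h.ifz_inv
    exact (ih₂ hc).of_reduces (hr ((ih₁ hb).reduces_numeral 0 rfl))
  | ifz_succ _ _ ih₁ ih₂ =>
    obtain ⟨b, c, d, hb, _, hd, _, hr⟩ := h.ifz_inv
    exact (ih₂ hd).of_reduces (hr _ ((ih₁ hb).reduces_numeral _ rfl))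
  | fix _ ih =>
    obtain ⟨b, hb, hr⟩ := h.fix_inv
    exact (ih hb).of_reduces hr
  | beta _ _ ih₁ ih₂ =>
    obtain ⟨b, c, hb, hc, hr⟩ := h.app_inv
    obtain ⟨d, hd, hr'⟩ := (ih₁ hb).reduces_inst _ rfl c _ hc
    exact (ih₂ hd).of_reduces (hr.trans hr')

end AddressTable

theorem mainTheorem1 {A : Type*} [Countable A] (t : AddressTable A) (P : PCF 0) (n : ℕ)
    (hty : PCF.HasType (Fin.elim0 : Fin 0 → Ty) P Ty.int)
    (hP : PCF.Eval P (PCF.numeral n)) :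
    t.Reduces (P.toETerm.trans t) (t.numeral n) := by
  have h := (AddressTable.realizes_trans (t := t) P).behaves hP
  rw [AddressTable.lookup_addr] at h
  exact h.reduces_numeral n rfl
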